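/- Let $n \ge k \ge 1$ and $r \ge 2$ be integers, and let $e_d(x_1^r,\dots,x_n^r) = \sum_{i_1<\cdots<i_d} x_{i_1}^r\cdots x_{i_d}^r$ in $\mathbb{C}[\mathbf{x}_n] = \mathbb{C}[x_1,\dots,x_n]$. Put $$I_{n,k} = \langle x_1^{kr+1},\dots,x_n^{kr+1},\ e_n(x_1^r,\dots,x_n^r), e_{n-1}(x_1^r,\dots,x_n^r),\dots,e_{n-k+1}(x_1^r,\dots,x_n^r)\rangle,$$ $$J_{n,k} = \langle x_1^{kr},\dots,x_n^{kr},\ e_n(x_1^r,\dots,x_n^r), e_{n-1}(x_1^r,\dots,x_n^r),\dots,e_{n-k+1}(x_1^r,\dots,x_n^r)\rangle,$$ $R_{n,k} = \mathbb{C}[\mathbf{x}_n]/I_{n,k}$ and $S_{n,k} = \mathbb{C}[\mathbf{x}_n]/J_{n,k}$. For $S = \{s_1<\cdots<s_m\}\subseteq\{1,\dots,n\}$ let $\mathbf{x}(S) = x_{s_1}^{s_1}x_{s_2}^{s_2-1}\cdots x_{s_m}^{s_m-m+1}$. A monomial $m$ in $x_1,\dots,x_n$ is called $(n,k)$-nonskip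 if $x_i^{kr+1}\nmid m$ for $1\le i\le n$ and $\mathbf{x}(S)^r\nmid m$ for all $S\subseteq\{1,\dots,n\}$ with $|S| = n-k+1$; it is called strongly $(n,k)$-nonskip if moreover $x_i^{kr}\nmid m$ for $1\le i\le n$. Let $\mathcal{M}_{n,k}$ and $\mathcal{N}_{n,k}$ be the sets of $(n,k)$-nonskip and of strongly $(n,k)$-nonskip monomials. Order monomials lexicographically: $x_1^{a_1}\cdots x_n^{a_n} < x_1^{b_1}\cdots x_n^{b_n}$ if $a_1=b_1,\dots,a_{i-1}=b_{i-1}$ and $a_i<b_i$ for some $i$. For an ideal $I$, let $\mathrm{in}_<(I)$ be the ideal generated by the leading terms of the nonzero elements of $I$. The standard monomial basis of $\mathbb{C}[\mathbf{x}_n]/I$ is the set of monomials not contained in $\mathrm{in}_<(I)$, whose classes form a $\mathbb{C}$-vector space basis of $\mathbb{C}[\mathbf{x}_n]/I$. **Theorem.** (1) $\mathcal{M}_{n,k}$ is the standard monomial basis of $R_{n,k}$: it is the set of all monomials not in $\mathrm{in}_<(I_{n,k})$, and the classes of its elements are a $\mathbb{C}$-basis of $R_{n,k}$. (2) $\mathcal{N}_{n,k}$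 is the standard monomial basis of $S_{n,k}$: it is the set of all monomials not in $\mathrm{in}_<(J_{n,k})$, and the classes of its elements are a $\mathbb{C}$-basis of $S_{n,k}$. -/

import Mathlib

noncomputable section

namespace GeneralizedCoinvariant

open MvPolynomial

/-- The elementary symmetric polynomial `e_d(x_1^r, …, x_n^r)` in the `r`-th powers of the
variables. -/
def esymmPow (n r d : ℕ) : MvPolynomial (Fin n) ℂ :=
  expand r (esymm (Fin n) ℂ d)

/-- The ideal `I_{n,k}` generated by the powers `x_i^{kr+1}` and by `e_d(x_1^r, …, x_n^r)` for
`n - k + 1 ≤ d ≤ n`. -/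
def idealI (n k r : ℕ) : Ideal (MvPolynomial (Fin n) ℂ) :=
  Ideal.span ({f | ∃ i : Fin n, f = X i ^ (k * r + 1)} ∪
    {f | ∃ d : ℕ, n - k + 1 ≤ d ∧ d ≤ n ∧ f = esymmPow n r d})

/-- The ideal `J_{n,k}` generated by the powers `x_i^{kr}` and by `e_d(x_1^r, …, x_n^r)` for
`n - k + 1 ≤ d ≤ n`. -/
def idealJ (n k r : ℕ) : Ideal (MvPolynomial (Fin n) ℂ) :=
  Ideal.span ({f | ∃ i : Fin n, f = X i ^ (k * r)} ∪
    {f | ∃ d : ℕ, n - k + 1 ≤ d ∧ d ≤ n ∧ f = esymmPow n r d})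

/-- The skip monomial `x(S) = x_{s_1}^{s_1} x_{s_2}^{s_2 - 1} ⋯ x_{s_m}^{s_m - m + 1}` of
`S = {s_1 < ⋯ < s_m} ⊆ [n]`. The element `i : Fin n` stands for the letter `i + 1` of `[n]`; when
it is `s_j`, then `j - 1` is the number of smaller elements of `S`, which is at most `i`, so that
the subtraction does not truncate. -/
def skipMonomial {n : ℕ} (S : Finset (Fin n)) : MvPolynomial (Fin n) ℂ :=
  ∏ i ∈ S, X i ^ (((i : ℕ) + 1) - (S.filter (· < i)).card)

/-- The exponent vector `a` belongs to an `(n,k)`-nonskip monomial `x^a`. -/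
def IsNonskip (n k r : ℕ) (a : Fin n →₀ ℕ) : Prop :=
  (∀ i : Fin n, ¬ (X i ^ (k * r + 1) : MvPolynomial (Fin n) ℂ) ∣ monomial a 1) ∧
  ∀ S : Finset (Fin n), S.card = n - k + 1 → ¬ skipMonomial S ^ r ∣ monomial a 1

/-- The exponent vector `a` belongs to a strongly `(n,k)`-nonskip monomial `x^a`. -/
def IsStronglyNonskip (n k r : ℕ) (a : Fin n →₀ ℕ) : Prop :=
  IsNonskip n k r a ∧
  ∀ i : Fin n, ¬ (X i ^ (k * r) : MvPolynomial (Fin n) ℂ) ∣ monomial a 1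

/-- The (exponent vectors of the) `(n,k)`-nonskip monomials `M_{n,k}`. -/
def nonskipMonomials (n k r : ℕ) : Set (Fin n →₀ ℕ) :=
  {a | IsNonskip n k r a}

/-- The (exponent vectors of the) strongly `(n,k)`-nonskip monomials `N_{n,k}`. -/
def stronglyNonskipMonomials (n k r : ℕ) : Set (Fin n →₀ ℕ) :=
  {a | IsStronglyNonskip n k r a}

/-- The initial ideal of `I`, generated by the leading terms of the nonzero elements of `I`. -/
def initialIdeal {n : ℕ} (m : MonomialOrder (Fin n)) (I : Ideal (MvPolynomial (Fin n) ℂ)) :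
    Ideal (MvPolynomial (Fin n) ℂ) :=
  Ideal.span {t | ∃ f ∈ I, f ≠ 0 ∧ t = m.leadingTerm f}

/-- The (exponent vectors of the) monomials that do not lie in the initial ideal of `I`. -/
def standardMonomials {n : ℕ} (m : MonomialOrder (Fin n)) (I : Ideal (MvPolynomial (Fin n) ℂ)) :
    Set (Fin n →₀ ℕ) :=
  {a | (monomial a 1 : MvPolynomial (Fin n) ℂ) ∉ initialIdeal m I}

/-- The monomials `x^a` with `a ∈ M` are the standard monomial basis of `ℂ[x_1, …, x_n] / I`: they
are exactly the monomials outside the initial ideal of `I`, and their classes form a basis of the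
quotient as a complex vector space. -/
def IsStandardMonomialBasis {n : ℕ} (m : MonomialOrder (Fin n))
    (I : Ideal (MvPolynomial (Fin n) ℂ)) (M : Set (Fin n →₀ ℕ)) : Prop :=
  M = standardMonomials m I ∧
  LinearIndependent ℂ
    (fun a : M => (Ideal.Quotient.mk I (monomial (a : Fin n →₀ ℕ) (1 : ℂ)) :
      MvPolynomial (Fin n) ℂ ⧸ I)) ∧
  Submodule.span ℂ (Set.range
    (fun a : M => (Ideal.Quotient.mk I (monomial (a : Fin n →₀ ℕ) (1 : ℂ)) :
      MvPolynomial (Fin n) ℂ ⧸ I))) = ⊤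

end GeneralizedCoinvariant

end

/-! Both parts are instances of `isStandardMonomialBasis_of_card`, for a finite set `V ⊆ ℂ` whose
cardinality is the exponent of the pure powers in the ideal. It suffices to show that the leading
exponents of the ideal are exactly the exponents that are not nonskip.

Skipping exponents do occur. The pure powers are generators, and for `|S| = n - k + 1` a determinant
of complete homogeneous polynomials in `x_{s_j}^r, …, x_n^r` lies in the ideal and has leading
monomial `x(S)^r` (`exists_degree_eq_skipExponent`).

No others occur, by deforming the ideal to a finite point set. Let `A` consist of `k` nonzero
numbers, let `V` be the set of their `r`-th roots (with `0` added for `I_{n,k}`), and let `Y` be the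
set of points of `V^n` whose `r`-th powers cover `A`. Every generator is the top homogeneous
component of a polynomial vanishing on `Y`, so every lex leading exponent of the ideal is a
degree-lex leading exponent of the vanishing ideal of `Y`. Scanning an exponent from right to left
gives a finite set that contains all nonskip exponents (`exists_skip_of_not_scanSucceeds`) and
injects into `Y` (`card_scanExponents_le`). Every exponent outside this set is a leading exponent,
so its monomials span the functions on `Y`; by the count they form a basis, and none of them is a
leading monomial (`degree_notMem_of_card_le`). -/

noncomputable section

namespace GeneralizedCoinvariant

open MvPolynomial MonomialOrder

/-! ### Reduction modulo leading monomials, and standard monomial bases. -/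

/-- A nonzero polynomial in the kernel of a linear map expresses the image of its leading monomial
through the images of smaller monomials. -/
lemma map_monomial_degree_mem_span {σ K V : Type*} [Field K] [AddCommGroup V] [Module K V]
    (m : MonomialOrder σ) (φ : MvPolynomial σ K →ₗ[K] V) {F : MvPolynomial σ K} (hF : F ≠ 0)
    (h : φ F = 0) :
    φ (monomial (m.degree F) 1) ∈
      Submodule.span K ((fun c => φ (monomial c 1)) '' {c | c ≺[m] m.degree F}) := by
  classical
  have hsum : F = ∑ c ∈ F.support, coeff c F • monomial c (1 : K) := by
    conv_lhs => rw [F.as_sum]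
    exact Finset.sum_congr rfl fun c _ => by rw [smul_monomial, smul_eq_mul, mul_one]
  have hmem := m.degree_mem_support hF
  have h0 : coeff (m.degree F) F ≠ 0 := mem_support_iff.mp hmem
  rw [hsum, map_sum, ← Finset.add_sum_erase _ _ hmem, map_smul] at h
  have h1 := eq_neg_of_add_eq_zero_left h
  rw [← inv_smul_smul₀ h0 (φ (monomial (m.degree F) 1)), h1]
  refine Submodule.smul_mem _ _ (Submodule.neg_mem _ (Submodule.sum_mem _ fun c hc => ?_))
  rw [map_smul]
  refine Submodule.smul_mem _ _ (Submodule.subset_span ⟨c, ?_, rfl⟩)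
  rw [Finset.mem_erase] at hc
  refine lt_of_le_of_ne (m.le_degree hc.2) fun h => hc.1 (m.toSyn.injective h)

/-- If every monomial outside `N` is the leading monomial of an element of the kernel, then the
image of each monomial is a combination of images of monomials of `N` that are not larger. -/
lemma map_monomial_mem_span {σ K V : Type*} [Field K] [AddCommGroup V] [Module K V]
    (m : MonomialOrder σ) (φ : MvPolynomial σ K →ₗ[K] V) (N : Set (σ →₀ ℕ))
    (h : ∀ a, a ∉ N → ∃ F, F ≠ 0 ∧ φ F = 0 ∧ m.degree F = a) (b : σ →₀ ℕ) :
    φ (monomial b 1) ∈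
      Submodule.span K ((fun c => φ (monomial c 1)) '' {c | c ∈ N ∧ c ≼[m] b}) := by
  obtain ⟨s, rfl⟩ := m.toSyn.symm.surjective b
  induction s using WellFoundedLT.induction with
  | ind s ih =>
    by_cases hs : m.toSyn.symm s ∈ N
    · exact Submodule.subset_span ⟨_, ⟨hs, le_rfl⟩, rfl⟩
    · obtain ⟨F, hF0, hF, hd⟩ := h _ hs
      have := map_monomial_degree_mem_span m φ hF0 hF
      rw [hd] at this
      refine Submodule.span_le.mpr ?_ this
      rintro _ ⟨c, hc, rfl⟩
      simp only [Set.mem_ofPred_eq, AddEquiv.apply_symm_apply] at hc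
      have := ih _ hc
      rw [AddEquiv.symm_apply_apply] at this
      refine Submodule.span_mono (Set.image_mono ?_) this
      rintro e ⟨he, hle⟩
      exact ⟨he, by simpa using hle.trans hc.le⟩

/-- Leading coefficients are units, so the initial ideal is a monomial ideal. Multiplying by a
monomial shifts the degree, so the set of leading exponents is already upward closed. -/
lemma monomial_mem_initialIdeal_iff {n : ℕ} (m : MonomialOrder (Fin n))
    (I : Ideal (MvPolynomial (Fin n) ℂ)) (a : Fin n →₀ ℕ) :
    monomial a 1 ∈ initialIdeal m I ↔ ∃ f ∈ I, f ≠ 0 ∧ m.degree f = a := by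
  have hI : initialIdeal m I = Ideal.span ((fun s => monomial s (1 : ℂ)) ''
      {b | ∃ f ∈ I, f ≠ 0 ∧ m.degree f = b}) := by
    apply le_antisymm
    · refine Ideal.span_le.mpr ?_
      rintro _ ⟨f, hf, hf0, rfl⟩
      have : m.leadingTerm f = C (m.leadingCoeff f) * monomial (m.degree f) 1 := by
        rw [C_mul_monomial, mul_one]; rfl
      rw [this]
      exact Ideal.mul_mem_left _ _ (Ideal.subset_span ⟨_, ⟨f, hf, hf0, rfl⟩, rfl⟩)
    · refine Ideal.span_le.mpr ?_
      rintro _ ⟨_, ⟨f, hf, hf0, rfl⟩, rfl⟩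
      have h0 : m.leadingCoeff f ≠ 0 := by rwa [Ne, leadingCoeff_eq_zero_iff]
      have : monomial (m.degree f) (1 : ℂ) = C (m.leadingCoeff f)⁻¹ * m.leadingTerm f := by
        rw [leadingTerm, C_mul_monomial, inv_mul_cancel₀ h0]
      change monomial (m.degree f) (1 : ℂ) ∈ _
      rw [this]
      exact Ideal.mul_mem_left _ _ (Ideal.subset_span ⟨f, hf, hf0, rfl⟩)
  rw [hI, mem_ideal_span_monomial_image]
  constructor
  · intro h
    obtain ⟨_, ⟨f, hf, hf0, rfl⟩, hle⟩ := h a (by simp [mem_support_iff])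
    refine ⟨monomial (a - m.degree f) 1 * f, Ideal.mul_mem_left _ _ hf, ?_, ?_⟩
    · exact mul_ne_zero (by simp) hf0
    · classical
      rw [degree_mul (by simp) hf0, degree_monomial, if_neg one_ne_zero,
        tsub_add_cancel_of_le hle]
  · rintro h xi hxi
    classical
    rw [support_monomial, if_neg one_ne_zero, Finset.mem_singleton] at hxi
    exact ⟨a, h, hxi.ge⟩

/-- A linear relation among the classes lifts to a nonzero element of `I` supported on `M`, whose
leading exponent would then lie in `M`. Spanning is reduction by leading monomials. -/
theorem isStandardMonomialBasis_of_mem_iff {n : ℕ} (m : MonomialOrder (Fin n))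
    (I : Ideal (MvPolynomial (Fin n) ℂ)) (M : Set (Fin n →₀ ℕ))
    (h : ∀ a, a ∈ M ↔ ¬ ∃ f ∈ I, f ≠ 0 ∧ m.degree f = a) : IsStandardMonomialBasis m I M := by
  classical
  let φ : MvPolynomial (Fin n) ℂ →ₗ[ℂ] (MvPolynomial (Fin n) ℂ ⧸ I) :=
    (Ideal.Quotient.mkₐ ℂ I).toLinearMap
  have hφ : ∀ f, φ f = Ideal.Quotient.mk I f := fun f => rfl
  refine ⟨?_, ?_, ?_⟩
  · ext a
    rw [h a, standardMonomials, Set.mem_ofPred_eq, monomial_mem_initialIdeal_iff]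
  · rw [linearIndependent_iff]
    intro l hl
    by_contra hl0
    let f : MvPolynomial (Fin n) ℂ := ∑ a ∈ l.support, monomial (a : Fin n →₀ ℕ) (l a)
    have hcoeff : ∀ c, coeff c f ≠ 0 → c ∈ M := by
      intro c hc
      by_contra hcM
      apply hc
      simp only [f, coeff_sum, coeff_monomial]
      refine Finset.sum_eq_zero fun a _ => if_neg ?_
      rintro rfl
      exact hcM a.2
    obtain ⟨a, ha⟩ := Finsupp.ne_iff.mp hl0
    have hfa : coeff (a : Fin n →₀ ℕ) f = l a := by
      simp only [f, coeff_sum, coeff_monomial]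
      rw [Finset.sum_eq_single a]
      · simp
      · intro b _ hb
        exact if_neg fun h => hb (Subtype.ext h)
      · intro h; simpa using h
    have hf0 : f ≠ 0 := by
      intro h0
      rw [h0, coeff_zero] at hfa
      exact ha hfa.symm
    have hfI : f ∈ I := by
      rw [← Ideal.Quotient.eq_zero_iff_mem, ← hφ, ← hl, Finsupp.linearCombination_apply,
        Finsupp.sum, map_sum]
      refine Finset.sum_congr rfl fun b _ => ?_
      rw [← hφ, ← map_smul, smul_monomial, smul_eq_mul, mul_one]
    exact (h _).mp (hcoeff _ (mem_support_iff.mp (m.degree_mem_support hf0))) ⟨f, hfI, hf0, rfl⟩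
  · rw [eq_top_iff]
    rintro x -
    obtain ⟨f, rfl⟩ := Ideal.Quotient.mk_surjective x
    rw [← hφ, f.as_sum, map_sum]
    refine Submodule.sum_mem _ fun b _ => ?_
    have hb : monomial b (coeff b f) = coeff b f • monomial b (1 : ℂ) := by
      rw [smul_monomial, smul_eq_mul, mul_one]
    rw [hb, map_smul]
    refine Submodule.smul_mem _ _ ?_
    have := map_monomial_mem_span m φ M (fun a ha => by
      rw [h a, not_not] at ha
      obtain ⟨f, hf, hf0, hd⟩ := ha
      exact ⟨f, hf0, by rwa [hφ, Ideal.Quotient.eq_zero_iff_mem], hd⟩) b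
    refine Submodule.span_mono ?_ this
    rintro _ ⟨c, hc, rfl⟩
    exact ⟨⟨c, hc.1⟩, rfl⟩

/-! ### Leading monomials of polynomials vanishing on a finite point set. -/

/-- Evaluation at the points of a finite set. -/
def evalOn {σ K : Type*} [Field K] (Y : Finset (σ → K)) : MvPolynomial σ K →ₗ[K] (Y → K) :=
  LinearMap.pi fun y => (aeval (y : σ → K)).toLinearMap

lemma evalOn_apply {σ K : Type*} [Field K] (Y : Finset (σ → K)) (f : MvPolynomial σ K) (y : Y) :
    evalOn Y f y = eval (y : σ → K) f := by
  simp [evalOn]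

lemma evalOn_eq_zero_iff {σ K : Type*} [Field K] (Y : Finset (σ → K)) (f : MvPolynomial σ K) :
    evalOn Y f = 0 ↔ ∀ y ∈ Y, eval y f = 0 := by
  simp [funext_iff, evalOn_apply]

lemma evalOn_surjective {σ K : Type*} [Field K] (Y : Finset (σ → K)) :
    Function.Surjective (evalOn Y) := by
  classical
  have hsep : ∀ y z : Y, ∃ p : MvPolynomial σ K,
      eval (y : σ → K) p = 1 ∧ (z ≠ y → eval (z : σ → K) p = 0) := by
    intro y z
    by_cases hzy : z = y
    · exact ⟨1, map_one _, fun h => (h hzy).elim⟩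
    · obtain ⟨i, hi⟩ := Function.ne_iff.mp fun h => hzy (Subtype.ext h)
      refine ⟨C ((y : σ → K) i - (z : σ → K) i)⁻¹ * (X i - C ((z : σ → K) i)), ?_, fun _ => ?_⟩
      · simp [inv_mul_cancel₀ (sub_ne_zero.mpr (Ne.symm hi))]
      · simp
  choose p hp1 hp0 using hsep
  intro g
  refine ⟨∑ y, C (g y) * ∏ z, p y z, funext fun w => ?_⟩
  rw [evalOn_apply, map_sum, Finset.sum_eq_single w]
  · simp [map_prod, hp1]
  · intro y _ hy
    rw [map_mul, map_prod, Finset.prod_eq_zero (Finset.mem_univ w) (hp0 y w hy.symm), mul_zero]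
  · simp

/-- If `N` has at most as many elements as `Y` and every exponent outside `N` is the degree of a
polynomial vanishing on `Y`, then no nonzero polynomial vanishing on `Y` has its degree in `N`. -/
theorem degree_notMem_of_card_le {σ K : Type*} [Field K] (m : MonomialOrder σ)
    (Y : Finset (σ → K)) (N : Finset (σ →₀ ℕ)) (hcard : N.card ≤ Y.card)
    (h : ∀ a, a ∉ N → ∃ F, F ≠ 0 ∧ (∀ y ∈ Y, eval y F = 0) ∧ m.degree F = a)
    {F : MvPolynomial σ K} (hF0 : F ≠ 0) (hF : ∀ y ∈ Y, eval y F = 0) : m.degree F ∉ N := by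
  classical
  intro hN
  let v : N → (Y → K) := fun a => evalOn Y (monomial (a : σ →₀ ℕ) 1)
  have hspan := map_monomial_mem_span m (evalOn Y) (N : Set (σ →₀ ℕ)) (fun a ha => by
    simpa only [evalOn_eq_zero_iff] using h a ha)
  have htop : ⊤ ≤ Submodule.span K (Set.range v) := by
    rintro x -
    obtain ⟨f, rfl⟩ := evalOn_surjective Y x
    rw [f.as_sum, map_sum]
    refine Submodule.sum_mem _ fun b _ => ?_
    have hb : monomial b (coeff b f) = coeff b f • monomial b (1 : K) := by
      rw [smul_monomial, smul_eq_mul, mul_one]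
    rw [hb, map_smul]
    refine Submodule.smul_mem _ _ (Submodule.span_mono ?_ (hspan b))
    rintro _ ⟨c, hc, rfl⟩
    exact ⟨⟨c, hc.1⟩, rfl⟩
  have hrank : Module.finrank K (Y → K) = Y.card := by simp
  have hle : Y.card ≤ N.card := by
    have := finrank_range_le_card (R := K) v
    rw [Set.finrank, top_le_iff.mp htop, finrank_top, hrank] at this
    simpa using this
  have hli : LinearIndependent K v :=
    linearIndependent_of_top_le_span_of_card_eq_finrank htop (by
      rw [hrank]; simpa using le_antisymm hcard hle)
  -- `F` rewrites its leading monomial through smaller ones, and each of these reduces to still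
  -- smaller or equal monomials of `N`. So one basis vector would lie in the span of the others.
  refine linearIndependent_iff_notMem_span.mp hli ⟨_, hN⟩ ?_
  have h1 := map_monomial_degree_mem_span m (evalOn Y) hF0 ((evalOn_eq_zero_iff Y F).mpr hF)
  refine Submodule.span_le.mpr ?_ h1
  rintro _ ⟨c, hc, rfl⟩
  refine Submodule.span_mono ?_ (hspan c)
  rintro _ ⟨e, ⟨he, hec⟩, rfl⟩
  refine ⟨⟨e, he⟩, ⟨trivial, fun h => ?_⟩, rfl⟩
  have : e = m.degree F := congrArg Subtype.val h
  rw [this] at hec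
  exact absurd hc (not_lt.mpr hec)

/-! ### Generating functions of elementary and complete homogeneous polynomials. -/

/-- The complete homogeneous symmetric polynomial of degree `p` in the values `w i`, `i ∈ T`. -/
def completeHom {ι R : Type*} [CommRing R] (w : ι → R) (T : Finset ι) (p : ℕ) : R :=
  PowerSeries.coeff p (∏ i ∈ T, PowerSeries.mk fun q => w i ^ q)

lemma completeHom_zero {ι R : Type*} [CommRing R] (w : ι → R) (T : Finset ι) :
    completeHom w T 0 = 1 := by
  simp [completeHom, PowerSeries.coeff_zero_eq_constantCoeff, map_prod]

lemma coeff_prod_one_sub {ι R : Type*} [CommRing R] (w : ι → R) (T : Finset ι) (d : ℕ) :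
    PowerSeries.coeff d (∏ i ∈ T, (1 - PowerSeries.C (w i) * PowerSeries.X)) =
      (-1) ^ d * ∑ t ∈ T.powersetCard d, ∏ i ∈ t, w i := by
  classical
  have h : ∀ i, (1 - PowerSeries.C (w i) * PowerSeries.X : PowerSeries R) =
      1 + PowerSeries.monomial 1 (-w i) := by
    intro i
    ext n
    simp [PowerSeries.coeff_X, PowerSeries.coeff_C_mul, PowerSeries.coeff_monomial,
      sub_eq_add_neg]
  simp_rw [h]
  rw [Finset.prod_one_add, map_sum, Finset.mul_sum, Finset.powersetCard_eq_filter,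
    Finset.sum_filter]
  refine Finset.sum_congr rfl fun t _ => ?_
  rw [PowerSeries.prod_monomial, PowerSeries.coeff_monomial, Finset.prod_neg]
  simp only [Finset.sum_const, smul_eq_mul, mul_one]
  by_cases hd : t.card = d
  · simp [hd]
  · rw [if_neg (Ne.symm hd), if_neg hd]

lemma mk_pow_mul_one_sub {R : Type*} [CommRing R] (a : R) :
    (PowerSeries.mk fun q => a ^ q) * (1 - PowerSeries.C a * PowerSeries.X) = 1 := by
  ext n
  rw [mul_sub, mul_one, mul_left_comm, map_sub, PowerSeries.coeff_C_mul]
  cases n with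
  | zero => simp
  | succ n => simp [PowerSeries.coeff_succ_mul_X, pow_succ', PowerSeries.coeff_one]

/-- Multiplying the generating functions of the elementary symmetric polynomials in all variables
and of the complete homogeneous ones in the variables of `T` leaves the polynomial
`∏ (1 - w i t)` over the complement of `T`, whose degree is at most its cardinality. -/
theorem sum_esymm_mul_completeHom {ι R : Type*} [CommRing R] [Fintype ι] [DecidableEq ι]
    (w : ι → R) (T : Finset ι) {d : ℕ} (hd : Tᶜ.card < d) :
    ∑ l ∈ Finset.range (d + 1), (-1) ^ l * (∑ t ∈ Finset.univ.powersetCard l, ∏ i ∈ t, w i) *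
      completeHom w T (d - l) = 0 := by
  have h : (∏ i, (1 - PowerSeries.C (w i) * PowerSeries.X)) *
      ∏ i ∈ T, PowerSeries.mk (fun q => w i ^ q) =
      ∏ i ∈ Tᶜ, (1 - PowerSeries.C (w i) * PowerSeries.X) := by
    have h1 : ∏ i ∈ T, ((1 - PowerSeries.C (w i) * PowerSeries.X) *
        PowerSeries.mk fun q => w i ^ q) = 1 :=
      Finset.prod_eq_one fun i _ => by rw [mul_comm, mk_pow_mul_one_sub]
    rw [← Finset.prod_compl_mul_prod T, mul_assoc, ← Finset.prod_mul_distrib, h1, mul_one]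
  have h2 := congrArg (PowerSeries.coeff d) h
  rw [coeff_prod_one_sub, Finset.powersetCard_eq_empty.mpr hd, Finset.sum_empty, mul_zero,
    PowerSeries.coeff_mul, Finset.Nat.sum_antidiagonal_eq_sum_range_succ_mk] at h2
  rw [← h2]
  refine Finset.sum_congr rfl fun l _ => ?_
  rw [coeff_prod_one_sub]
  rfl

/-! ### Determinants whose leading monomials are powers of skip monomials. -/

lemma esymmPow_eq (n r d : ℕ) :
    esymmPow n r d = ∑ t ∈ Finset.univ.powersetCard d, ∏ i ∈ t, (X i ^ r) := by
  simp [esymmPow, esymm, map_sum, map_prod, expand_X]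

/-- Cramer's rule: `adj(H) H v = det(H) v`, read at an entry where `v` is `1`. -/
lemma det_mem_of_mulVec_mem {R ι : Type*} [CommRing R] [Fintype ι] [DecidableEq ι] (I : Ideal R)
    (H : Matrix ι ι R) (v : ι → R) (i : ι) (hv : v i = 1) (h : ∀ j, (H.mulVec v) j ∈ I) :
    H.det ∈ I := by
  have h1 : H.det = (H.adjugate.mulVec (H.mulVec v)) i := by
    rw [Matrix.mulVec_mulVec, Matrix.adjugate_mul, Matrix.smul_mulVec, Matrix.one_mulVec,
      Pi.smul_apply, hv, smul_eq_mul, mul_one]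
  rw [h1]
  exact Ideal.sum_mem _ fun j _ => Ideal.mul_mem_left _ _ (h j)

lemma degree_eq_of_forall_le {σ R : Type*} [CommRing R] (m : MonomialOrder σ)
    {f : MvPolynomial σ R} {a : σ →₀ ℕ} (ha : coeff a f ≠ 0)
    (h : ∀ c, coeff c f ≠ 0 → c ≼[m] a) : m.degree f = a := by
  refine m.toSyn.injective (le_antisymm (h _ ?_) (m.le_degree (mem_support_iff.mpr ha)))
  rw [Ne, coeff_degree_eq_zero_iff]
  rintro rfl
  exact ha (coeff_zero _)

lemma completeHom_X_pow {n : ℕ} (r : ℕ) (T : Finset (Fin n)) (p : ℕ) :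
    completeHom (fun i => (X i ^ r : MvPolynomial (Fin n) ℂ)) T p =
      ∑ l ∈ T.finsuppAntidiag p, monomial (r • l) 1 := by
  rw [completeHom, PowerSeries.coeff_prod]
  refine Finset.sum_congr rfl fun l hl => ?_
  have hT := (Finset.mem_finsuppAntidiag.mp hl).2
  simp_rw [PowerSeries.coeff_mk, ← pow_mul]
  rw [monomial_eq, C_1, one_mul, Finsupp.prod_of_support_subset (s := T)]
  · rfl
  · exact fun i hi => hT (Finsupp.support_smul hi)
  · simp

lemma coeff_completeHom_Ici {n r : ℕ} (hr : 0 < r) (v : Fin n) (p : ℕ) :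
    coeff (Finsupp.single v (r * p))
      (completeHom (fun i => (X i ^ r : MvPolynomial (Fin n) ℂ)) (Finset.Ici v) p) = 1 := by
  classical
  rw [completeHom_X_pow, coeff_sum, Finset.sum_eq_single (Finsupp.single v p)]
  · simp
  · intro l _ hl
    rw [coeff_monomial, if_neg]
    intro h
    apply hl
    ext i
    have := DFunLike.congr_fun h i
    simp only [Finsupp.smul_apply, smul_eq_mul, Finsupp.single_apply] at this ⊢
    split_ifs at this ⊢ with hi
    · exact Nat.eq_of_mul_eq_mul_left hr this
    · exact (Nat.mul_eq_zero.mp this).resolve_left hr.ne'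
  · intro h
    refine (h ?_).elim
    rw [Finset.mem_finsuppAntidiag]
    refine ⟨?_, fun i hi => ?_⟩
    · simp [Finsupp.single_apply]
    · have := Finsupp.support_single_subset hi
      simp_all

lemma degree_completeHom_Ici {n r : ℕ} (hr : 0 < r) (v : Fin n) (p : ℕ) :
    (MonomialOrder.lex : MonomialOrder (Fin n)).degree
      (completeHom (fun i => (X i ^ r : MvPolynomial (Fin n) ℂ)) (Finset.Ici v) p) =
      Finsupp.single v (r * p) := by
  classical
  refine degree_eq_of_forall_le _ (by rw [coeff_completeHom_Ici hr]; exact one_ne_zero) ?_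
  intro c hc
  rw [completeHom_X_pow, coeff_sum] at hc
  obtain ⟨l, hl, hlc⟩ := Finset.exists_ne_zero_of_sum_ne_zero hc
  rw [coeff_monomial, ne_eq, ite_eq_right_iff, Classical.not_imp] at hlc
  obtain ⟨rfl, -⟩ := hlc
  obtain ⟨hsum, hsupp⟩ := Finset.mem_finsuppAntidiag.mp hl
  have hlow : ∀ i, i < v → l i = 0 := by
    intro i hi
    by_contra h
    exact absurd (Finset.mem_Ici.mp (hsupp (Finsupp.mem_support_iff.mpr h))) (not_le.mpr hi)
  have hle : l v ≤ p := by
    rw [← hsum]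
    exact Finset.single_le_sum (f := fun i => l i) (fun _ _ => Nat.zero_le _)
      (Finset.mem_Ici.mpr le_rfl)
  rcases hle.lt_or_eq with hlt | heq
  · apply le_of_lt
    rw [lex_lt_iff]
    refine ⟨v, fun i hi => ?_, ?_⟩
    · simp [hlow i hi, hi.ne']
    · simpa using Nat.mul_lt_mul_of_pos_left hlt hr
  · apply le_of_eq
    congr 1
    ext i
    rw [Finsupp.smul_apply, smul_eq_mul, Finsupp.single_apply]
    split_ifs with hi
    · rw [← hi, heq]
    · rw [Nat.mul_eq_zero]
      right
      by_cases hi2 : i ∈ Finset.Ici v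
      · have h2 := Finset.add_sum_erase (Finset.Ici v) (fun i => l i)
          (Finset.mem_Ici.mpr (le_refl v))
        rw [heq] at h2
        have h3 : ∑ x ∈ (Finset.Ici v).erase v, l x = 0 := by
          have : ∑ x ∈ Finset.Ici v, l x = p := hsum
          omega
        exact Finset.sum_eq_zero_iff.mp h3 i (Finset.mem_erase.mpr ⟨Ne.symm hi, hi2⟩)
      · exact hlow i (not_le.mp fun h => hi2 (Finset.mem_Ici.mpr h))

/-- The matrix of complete homogeneous polynomials `h_{s_j - l}(x_{s_j}^r, …, x_n^r)`, whose
determinant has the skip monomial of `{s_1 < ⋯ < s_m}` as its lexicographic leading monomial. -/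
def skipMatrix {n m : ℕ} (r : ℕ) (s : Fin m → Fin n) :
    Matrix (Fin m) (Fin m) (MvPolynomial (Fin n) ℂ) :=
  fun j l => if (l : ℕ) ≤ s j + 1 then
    completeHom (fun i => X i ^ r) (Finset.Ici (s j)) (s j + 1 - l) else 0

/-- Apply the matrix to the vector of signed `e_l` with `l < m`, whose entry at `0` is `1`. The
alternating sum over all `l ≤ s_j` vanishes because only `s_j - 1` variables precede `x_{s_j}`, so
each truncated sum is minus a combination of `e_l` with `l ≥ m`. -/
lemma det_skipMatrix_mem {n m : ℕ} (hm : 0 < m) (r : ℕ) (s : Fin m → Fin n) :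
    (skipMatrix r s).det ∈ Ideal.span {f | ∃ d : ℕ, m ≤ d ∧ d ≤ n ∧ f = esymmPow n r d} := by
  refine det_mem_of_mulVec_mem _ _ (fun l => (-1) ^ (l : ℕ) * esymmPow n r l) ⟨0, hm⟩ ?_ ?_
  · simp [esymmPow]
  · intro j
    let F : ℕ → MvPolynomial (Fin n) ℂ := fun l => if l ≤ s j + 1 then
      (-1) ^ l * esymmPow n r l *
        completeHom (fun i => X i ^ r) (Finset.Ici (s j)) (s j + 1 - l) else 0
    have h1 : (skipMatrix r s).mulVec (fun l => (-1) ^ (l : ℕ) * esymmPow n r l) j =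
        ∑ l ∈ Finset.range m, F l := by
      rw [Finset.sum_range]
      change ∑ l : Fin m, skipMatrix r s j l * ((-1) ^ (l : ℕ) * esymmPow n r l) = _
      refine Finset.sum_congr rfl fun l _ => ?_
      simp only [skipMatrix, F]
      split_ifs
      · ring
      · simp
    -- The range is long enough to be split both at `s j + 2`, where the identity applies, and at
    -- `m`, where the truncation occurs; the surplus terms are zero by the definition of `F`.
    have h2 : ∑ l ∈ Finset.range ((s j + 1 + 1) + m), F l = 0 := by
      rw [Finset.sum_range_add, ← add_zero (0 : MvPolynomial (Fin n) ℂ)]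
      congr 1
      · rw [← sum_esymm_mul_completeHom (fun i => (X i ^ r : MvPolynomial (Fin n) ℂ))
          (Finset.Ici (s j)) (d := s j + 1)]
        · refine Finset.sum_congr rfl fun l hl => ?_
          rw [Finset.mem_range] at hl
          simp only [F]
          rw [if_pos (by omega), esymmPow_eq]
        · rw [Finset.card_compl, Fin.card_Ici, Fintype.card_fin]
          omega
      · refine Finset.sum_eq_zero fun l _ => if_neg (by omega)
    rw [add_comm, Finset.sum_range_add] at h2
    rw [h1, eq_neg_of_add_eq_zero_left h2]
    refine neg_mem (Ideal.sum_mem _ fun l _ => ?_)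
    simp only [F]
    split_ifs with hl
    · refine Ideal.mul_mem_right _ _ (Ideal.mul_mem_left _ _ (Ideal.subset_span ?_))
      exact ⟨_, by omega, by omega, rfl⟩
    · exact zero_mem _

lemma val_le_val_of_strictMono {n m : ℕ} {s : Fin m → Fin n} (hs : StrictMono s) (j : Fin m) :
    (j : ℕ) ≤ s j := by
  obtain ⟨j, hj⟩ := j
  induction j with
  | zero => exact Nat.zero_le _
  | succ j ih =>
    have h1 := ih (by omega)
    have h2 : s ⟨j, by omega⟩ < s ⟨j + 1, hj⟩ := hs (by simp [Fin.lt_def])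
    simp only [Fin.lt_def] at h1 h2 ⊢
    omega

/-- Take the least moved point `j`. If `σ j < j`, then `σ j` would be fixed, against injectivity. -/
lemma exists_min_lt_apply {m : ℕ} {σ : Equiv.Perm (Fin m)} (hσ : σ ≠ 1) :
    ∃ j, j < σ j ∧ ∀ i < j, σ i = i := by
  obtain ⟨i, hi⟩ : ∃ i, σ i ≠ i := by
    by_contra! h
    exact hσ (Equiv.ext h)
  obtain ⟨j, hj, hmin⟩ := wellFounded_lt.has_min {i | σ i ≠ i} ⟨i, hi⟩
  have hlow : ∀ i < j, σ i = i := fun i hi => not_not.mp fun h => hmin i h hi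
  refine ⟨j, lt_of_le_of_ne (not_lt.mp fun h => hj ?_) (Ne.symm hj), hlow⟩
  exact σ.injective (hlow _ h)

lemma sum_single_apply {n m : ℕ} {s : Fin m → Fin n} (hs : Function.Injective s)
    (e : Fin m → ℕ) (j : Fin m) : (∑ i, Finsupp.single (s i) (e i)) (s j) = e j := by
  rw [Finsupp.finsetSum_apply, Finset.sum_eq_single j]
  · simp
  · intro i _ hi
    exact Finsupp.single_eq_of_ne fun h => hi (hs h.symm)
  · simp

lemma sum_single_apply_of_notMem {n m : ℕ} {s : Fin m → Fin n} (e : Fin m → ℕ) {i : Fin n}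
    (hi : i ∉ Set.range s) : (∑ j, Finsupp.single (s j) (e j)) i = 0 := by
  rw [Finsupp.finsetSum_apply]
  exact Finset.sum_eq_zero fun j _ => Finsupp.single_eq_of_ne fun h => hi ⟨j, h.symm⟩

/-- At the first index moved by `σ` the column index goes up, so the exponent of that variable goes
down, while all earlier variables keep theirs. -/
lemma sum_single_perm_lt {n m r : ℕ} (hr : 0 < r) {s : Fin m → Fin n} (hs : StrictMono s)
    {σ : Equiv.Perm (Fin m)} (hσ : σ ≠ 1) :
    (∑ j, Finsupp.single (s j) (r * (s j + 1 - σ j))) ≺[(MonomialOrder.lex : MonomialOrder (Fin n))]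
      ∑ j, Finsupp.single (s j) (r * (s j + 1 - j)) := by
  obtain ⟨j, hj, hlow⟩ := exists_min_lt_apply hσ
  rw [lex_lt_iff]
  refine ⟨s j, fun i hi => ?_, ?_⟩
  · simp only [ofLex_toLex]
    by_cases h : i ∈ Set.range s
    · obtain ⟨i, rfl⟩ := h
      rw [sum_single_apply hs.injective, sum_single_apply hs.injective, hlow i (hs.lt_iff_lt.mp hi)]
    · rw [sum_single_apply_of_notMem _ h, sum_single_apply_of_notMem _ h]
  · simp only [ofLex_toLex]
    rw [sum_single_apply hs.injective, sum_single_apply hs.injective]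
    have := val_le_val_of_strictMono hs j
    rw [Fin.lt_def] at hj
    exact Nat.mul_lt_mul_of_pos_left (by omega) hr

/-- In the Leibniz expansion the diagonal product strictly dominates all other nonzero products, so
its leading term cannot cancel. -/
lemma degree_det_skipMatrix {n m r : ℕ} (hr : 0 < r) {s : Fin m → Fin n} (hs : StrictMono s) :
    (skipMatrix r s).det ≠ 0 ∧
    (MonomialOrder.lex : MonomialOrder (Fin n)).degree (skipMatrix r s).det =
      ∑ j, Finsupp.single (s j) (r * (s j + 1 - j)) := by
  have hne : ∀ j l : Fin m, (l : ℕ) ≤ s j + 1 → skipMatrix r s j l ≠ 0 := by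
    intro j l hl h0
    rw [skipMatrix, if_pos hl] at h0
    have := coeff_completeHom_Ici hr (s j) (s j + 1 - l)
    rw [h0, coeff_zero] at this
    exact zero_ne_one this
  have hdeg : ∀ σ : Equiv.Perm (Fin m), ∏ j, skipMatrix r s j (σ j) ≠ 0 →
      (MonomialOrder.lex : MonomialOrder (Fin n)).degree (∏ j, skipMatrix r s j (σ j)) =
      ∑ j, Finsupp.single (s j) (r * (s j + 1 - σ j)) := by
    intro σ h0
    have h0' := Finset.prod_ne_zero_iff.mp h0
    rw [degree_prod h0']
    refine Finset.sum_congr rfl fun j _ => ?_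
    have hl : ((σ j : Fin m) : ℕ) ≤ s j + 1 := by
      by_contra hl
      exact h0' j (Finset.mem_univ _) (if_neg hl)
    rw [skipMatrix, if_pos hl, degree_completeHom_Ici hr]
  have hdet : (skipMatrix r s).det =
      ∑ σ : Equiv.Perm (Fin m), C ((Equiv.Perm.sign σ : ℤ) : ℂ) * ∏ j, skipMatrix r s j (σ j) := by
    rw [← Matrix.det_transpose, Matrix.det_apply']
    refine Finset.sum_congr rfl fun σ _ => ?_
    simp [Matrix.transpose_apply]
  have hone : ∏ j, skipMatrix r s j ((1 : Equiv.Perm (Fin m)) j) ≠ 0 :=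
    Finset.prod_ne_zero_iff.mpr fun j _ => hne _ _ (by
      have := val_le_val_of_strictMono hs j
      change (j : ℕ) ≤ s j + 1
      omega)
  have hcoeff : coeff (∑ j, Finsupp.single (s j) (r * (s j + 1 - j))) (skipMatrix r s).det ≠ 0 := by
    rw [hdet, coeff_sum, Finset.sum_eq_single 1]
    · have h := hdeg 1 hone
      simp only [Equiv.Perm.coe_one, id_eq] at h
      rw [coeff_C_mul, ← h]
      simpa [coeff_degree_eq_zero_iff] using hone
    · intro σ _ hσ
      rw [coeff_C_mul]
      by_cases h0 : ∏ j, skipMatrix r s j (σ j) = 0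
      · rw [h0, coeff_zero, mul_zero]
      · rw [coeff_eq_zero_of_lt (m := MonomialOrder.lex), mul_zero]
        rw [hdeg σ h0]
        exact sum_single_perm_lt hr hs hσ
    · simp
  refine ⟨fun h => hcoeff (by rw [h, coeff_zero]), degree_eq_of_forall_le _ hcoeff ?_⟩
  intro c hc
  rw [hdet, coeff_sum] at hc
  obtain ⟨σ, -, hσ⟩ := Finset.exists_ne_zero_of_sum_ne_zero hc
  rw [coeff_C_mul] at hσ
  have hcσ := right_ne_zero_of_mul hσ
  have h0 : ∏ j, skipMatrix r s j (σ j) ≠ 0 := fun h => hcσ (by rw [h, coeff_zero])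
  refine (le_degree (mem_support_iff.mpr hcσ)).trans ?_
  rw [hdeg σ h0]
  by_cases h1 : σ = 1
  · subst h1
    exact le_rfl
  · exact (sum_single_perm_lt hr hs h1).le

/-- The exponent of the `r`-th power of the skip monomial of `S`. -/
def skipExponent {n : ℕ} (r : ℕ) (S : Finset (Fin n)) : Fin n →₀ ℕ :=
  ∑ i ∈ S, Finsupp.single i (r * ((i : ℕ) + 1 - (S.filter (· < i)).card))

lemma skipMonomial_pow {n : ℕ} (r : ℕ) (S : Finset (Fin n)) :
    skipMonomial S ^ r = monomial (skipExponent r S) 1 := by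
  rw [skipMonomial, skipExponent, monomial_sum_one, ← Finset.prod_pow]
  refine Finset.prod_congr rfl fun i _ => ?_
  rw [← pow_mul, mul_comm, X_pow_eq_monomial]

lemma skipExponent_apply {n : ℕ} (r : ℕ) (S : Finset (Fin n)) (i : Fin n) :
    skipExponent r S i = if i ∈ S then r * ((i : ℕ) + 1 - (S.filter (· < i)).card) else 0 := by
  rw [skipExponent, Finsupp.finsetSum_apply]
  simp [Finsupp.single_apply]

theorem exists_degree_eq_skipExponent {n r : ℕ} (hr : 0 < r) (S : Finset (Fin n))
    (hS : 0 < S.card) :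
    ∃ f ∈ Ideal.span {f | ∃ d : ℕ, S.card ≤ d ∧ d ≤ n ∧ f = esymmPow n r d}, f ≠ 0 ∧
      (MonomialOrder.lex : MonomialOrder (Fin n)).degree f = skipExponent r S := by
  have hs := (S.orderEmbOfFin rfl).strictMono
  obtain ⟨h0, hd⟩ := degree_det_skipMatrix hr hs
  refine ⟨_, det_skipMatrix_mem hS r _, h0, ?_⟩
  rw [hd, skipExponent]
  conv_rhs => rw [← Finset.map_orderEmbOfFin_univ S rfl]
  rw [Finset.sum_map]
  refine Finset.sum_congr rfl fun j _ => ?_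
  have hcard : ((Finset.univ.map (S.orderEmbOfFin rfl).toEmbedding).filter
      (· < S.orderEmbOfFin rfl j)).card = j := by
    rw [Finset.filter_map, Finset.card_map]
    have : (Finset.univ.filter ((· < S.orderEmbOfFin rfl j) ∘ (S.orderEmbOfFin rfl).toEmbedding)) =
        Finset.Iio j := by
      ext i
      simp
    rw [this, Fin.card_Iio]
  rw [RelEmbedding.coe_toEmbedding, hcard]

/-! ### Top homogeneous components of polynomials vanishing on a set of points. -/

/-- The ideal of the polynomials each of whose homogeneous components is the top component of a
polynomial vanishing on `Y`. -/
def topIdeal {σ K : Type*} [Field K] (Y : Set (σ → K)) : Ideal (MvPolynomial σ K) where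
  carrier := {f | ∀ d : ℕ, ∃ F : MvPolynomial σ K, (∀ y ∈ Y, eval y F = 0) ∧
    ∀ c : σ →₀ ℕ, d ≤ c.degree → coeff c F = if c.degree = d then coeff c f else 0}
  zero_mem' := fun d => ⟨0, by simp, by simp⟩
  add_mem' := by
    intro f g hf hg d
    obtain ⟨F, hF, hFc⟩ := hf d
    obtain ⟨G, hG, hGc⟩ := hg d
    refine ⟨F + G, fun y hy => by rw [map_add, hF y hy, hG y hy, add_zero], fun c hc => ?_⟩
    rw [coeff_add, hFc c hc, hGc c hc]
    split_ifs <;> simp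
  smul_mem' := by
    classical
    intro g f hf d
    induction g using MvPolynomial.induction_on' with
    | monomial s u =>
      -- The degree `d` component of `x^s f` is `x^s` times the component of `f` of degree `d -
      -- |s|`, and it is zero if `|s| > d`; the truncated subtraction is harmless there.
      obtain ⟨F, hF, hFc⟩ := hf (d - s.degree)
      by_cases hd : s.degree ≤ d
      · refine ⟨monomial s u * F, fun y hy => by rw [map_mul, hF y hy, mul_zero], fun c hc => ?_⟩
        rw [smul_eq_mul, coeff_monomial_mul', coeff_monomial_mul']
        by_cases hs : s ≤ c
        · have hdeg : c.degree = (c - s).degree + s.degree := by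
            rw [← map_add, tsub_add_cancel_of_le hs]
          rw [if_pos hs, if_pos hs, hFc _ (by omega)]
          by_cases h : c.degree = d
          · rw [if_pos h, if_pos (by omega)]
          · rw [if_neg h, if_neg (by omega), mul_zero]
        · rw [if_neg hs, if_neg hs, ite_self]
      · refine ⟨0, by simp, fun c hc => ?_⟩
        rw [smul_eq_mul, coeff_monomial_mul', coeff_zero]
        by_cases h : c.degree = d
        · rw [if_pos h, if_neg]
          intro hs
          have := Finsupp.degree_mono hs
          omega
        · rw [if_neg h]
    | add p q hp hq =>
      obtain ⟨F, hF, hFc⟩ := hp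
      obtain ⟨G, hG, hGc⟩ := hq
      refine ⟨F + G, fun y hy => by rw [map_add, hF y hy, hG y hy, add_zero], fun c hc => ?_⟩
      rw [coeff_add, hFc c hc, hGc c hc, add_smul, coeff_add]
      split_ifs <;> simp

lemma mem_topIdeal_of_isHomogeneous {σ K : Type*} [Field K] {Y : Set (σ → K)}
    {f F : MvPolynomial σ K} {e : ℕ} (hf : f.IsHomogeneous e) (hF : ∀ y ∈ Y, eval y F = 0)
    (h : ∀ c : σ →₀ ℕ, e ≤ c.degree → coeff c F = coeff c f) : f ∈ topIdeal Y := by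
  intro d
  by_cases hd : d = e
  · subst hd
    refine ⟨F, hF, fun c hc => ?_⟩
    rw [h c hc]
    split_ifs with hcd
    · rfl
    · exact hf.coeff_eq_zero hcd
  · refine ⟨0, by simp, fun c _ => ?_⟩
    rw [coeff_zero]
    split_ifs with hcd
    · exact (hf.coeff_eq_zero (by omega)).symm
    · rfl

/-- The witness has the component of `f` in degree `|a|` as its top component, plus uncontrolled
terms of lower degree. Comparing degrees first discards the latter, hence the change from lex to
degree-lex. -/
lemma exists_degLex_degree_eq {σ K : Type*} [Field K] [LinearOrder σ] [WellFoundedGT σ]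
    {Y : Set (σ → K)} {f : MvPolynomial σ K} (hf : f ∈ topIdeal Y) (hf0 : f ≠ 0) :
    ∃ F : MvPolynomial σ K, F ≠ 0 ∧ (∀ y ∈ Y, eval y F = 0) ∧
      (degLex : MonomialOrder σ).degree F = (MonomialOrder.lex : MonomialOrder σ).degree f := by
  set a := (MonomialOrder.lex : MonomialOrder σ).degree f with ha
  obtain ⟨F, hF, hFc⟩ := hf a.degree
  have h1 : coeff a F ≠ 0 := by
    rw [hFc a le_rfl, if_pos rfl]
    exact mem_support_iff.mp (degree_mem_support hf0)
  refine ⟨F, fun h => h1 (by rw [h, coeff_zero]), hF, degree_eq_of_forall_le _ h1 ?_⟩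
  intro c hc
  rw [degLex_le_iff, Finsupp.DegLex.le_iff]
  simp only [ofDegLex_toDegLex]
  by_cases hlt : c.degree < a.degree
  · exact Or.inl hlt
  · rw [hFc c (not_lt.mp hlt)] at hc
    split_ifs at hc with hd
    · exact Or.inr ⟨hd, le_degree (m := MonomialOrder.lex) (mem_support_iff.mpr hc)⟩
    · exact (hc rfl).elim

/-- The witness is `∏_{v ∈ V} (x_i - v)`. -/
lemma X_pow_mem_topIdeal {σ K : Type*} [Field K] {Y : Set (σ → K)} (V : Finset K) (i : σ)
    (h : ∀ y ∈ Y, y i ∈ V) : (X i ^ V.card : MvPolynomial σ K) ∈ topIdeal Y := by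
  classical
  let p : Polynomial K := ∏ v ∈ V, (Polynomial.X - Polynomial.C v)
  have hp : p.Monic := Polynomial.monic_prod_X_sub_C _ _
  have hdeg : p.natDegree = V.card := by simp [p]
  refine mem_topIdeal_of_isHomogeneous (F := Polynomial.aeval (X i) p) (isHomogeneous_X_pow i _)
    ?_ ?_
  · intro y hy
    simp only [p, map_prod, map_sub, Polynomial.aeval_X, Polynomial.aeval_C]
    exact Finset.prod_eq_zero (h y hy) (by simp [algebraMap_eq])
  · intro c hc
    rw [hp.as_sum, hdeg, map_add, coeff_add, map_sum, coeff_sum, Finset.sum_eq_zero]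
    · simp
    · intro j hj
      rw [map_mul, Polynomial.aeval_C, map_pow, Polynomial.aeval_X, algebraMap_eq, coeff_C_mul,
        (isHomogeneous_X_pow i j).coeff_eq_zero, mul_zero]
      rw [Finset.mem_range] at hj
      omega

lemma isHomogeneous_esymmPow (n r d : ℕ) : (esymmPow n r d).IsHomogeneous (r * d) := by
  rw [esymmPow_eq]
  refine IsHomogeneous.sum _ _ _ fun t ht => ?_
  have := IsHomogeneous.prod t (fun i => (X i ^ r : MvPolynomial (Fin n) ℂ)) (fun _ => r)
    fun i _ => isHomogeneous_X_pow i r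
  rwa [Finset.sum_const, (Finset.mem_powersetCard.mp ht).2, smul_eq_mul, mul_comm] at this

lemma eval_esymmPow {n : ℕ} (r d : ℕ) (y : Fin n → ℂ) :
    eval y (esymmPow n r d) = ∑ t ∈ Finset.univ.powersetCard d, ∏ i ∈ t, y i ^ r := by
  simp [esymmPow_eq, map_sum, map_prod]

/-- At a point of `Y` some coordinates `T` have `r`-th powers enumerating `A`, so the complete
homogeneous values on `T` are constants independent of the point. With these constants,
`sum_esymm_mul_completeHom` becomes a polynomial relation valid on `Y`, with top component `± e_d`.
-/
lemma esymmPow_mem_topIdeal {n r d : ℕ} (hr : 0 < r) {Y : Set (Fin n → ℂ)} (A : Finset ℂ)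
    (hY : ∀ y ∈ Y, ∀ x ∈ A, ∃ i, y i ^ r = x) (hd : n < d + A.card) :
    esymmPow n r d ∈ topIdeal Y := by
  classical
  let F : MvPolynomial (Fin n) ℂ := ∑ l ∈ Finset.range (d + 1),
    C ((-1) ^ l * completeHom id A (d - l)) * esymmPow n r l
  -- The factor `(-1)^d` cancels the sign of the term `l = d`.
  refine mem_topIdeal_of_isHomogeneous (F := C ((-1) ^ d) * F) (isHomogeneous_esymmPow n r d) ?_ ?_
  · intro y hy
    have hex : ∀ x : A, ∃ i, y i ^ r = x := fun x => hY y hy x x.2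
    choose g hg using hex
    have hinj : Function.Injective g := by
      intro x x' h
      apply Subtype.ext
      rw [← hg x, ← hg x', h]
    let T : Finset (Fin n) := Finset.univ.image g
    have hT : T.card = A.card := by
      rw [Finset.card_image_of_injective _ hinj, Finset.card_univ, Fintype.card_coe]
    have hh : ∀ p, completeHom (fun i => y i ^ r) T p = completeHom id A p := by
      intro p
      rw [completeHom, completeHom, Finset.prod_image fun _ _ _ _ h => hinj h]
      simp_rw [hg]
      rw [Finset.prod_coe_sort A fun x => PowerSeries.mk fun q => x ^ q]
      rfl
    have hle : A.card ≤ n := by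
      rw [← hT]
      exact (Finset.card_le_univ T).trans (by simp)
    have := sum_esymm_mul_completeHom (fun i => y i ^ r) T (d := d) (by
      rw [Finset.card_compl, hT, Fintype.card_fin]; omega)
    rw [map_mul, map_sum]
    refine mul_eq_zero_of_right _ ?_
    rw [← this]
    refine Finset.sum_congr rfl fun l _ => ?_
    rw [map_mul, eval_C, eval_esymmPow, hh]
    ring
  · intro c hc
    rw [coeff_C_mul]
    simp only [F]
    rw [coeff_sum, Finset.sum_range_succ, Finset.sum_eq_zero, zero_add, tsub_self,
      completeHom_zero, mul_one, coeff_C_mul, ← mul_assoc, ← mul_pow]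
    · simp
    · intro l hl
      rw [coeff_C_mul, (isHomogeneous_esymmPow n r l).coeff_eq_zero, mul_zero]
      have := Nat.mul_lt_mul_of_pos_left (Finset.mem_range.mp hl) hr
      omega

/-! ### The scan of an exponent, and its injection into the covering points. -/

/-- Reading `a` from the last entry to the first, with `e` values still to be attained, an entry
less than `r * e` attains one of them. The scan succeeds if none is left at the end. -/
def ScanSucceeds (r : ℕ) : (n : ℕ) → (Fin n → ℕ) → ℕ → Prop
  | 0, _, e => e = 0
  | n + 1, a, e => ScanSucceeds r n (Fin.init a) (if a (Fin.last n) < r * e then e - 1 else e)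

/-- Entries that attain no value are collected into `S`. When letter `n + 1` is collected with `e`
values left, `n + 1 - e` smaller letters will follow, so its skip exponent is exactly `r * e`, the
bound that the entry failed to stay below. -/
lemma exists_skip_of_not_scanSucceeds {r n : ℕ} {a : Fin n → ℕ} {e : ℕ}
    (h : ¬ ScanSucceeds r n a e) (he : e ≤ n + 1) :
    ∃ S : Finset (Fin n), S.card + e = n + 1 ∧
      ∀ i ∈ S, r * ((i : ℕ) + 1 - (S.filter (· < i)).card) ≤ a i := by
  induction n generalizing e with
  | zero =>
    refine ⟨∅, ?_, by simp⟩
    have : e ≠ 0 := h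
    simp
    omega
  | succ n ih =>
    rw [ScanSucceeds] at h
    have hfilter : ∀ (S : Finset (Fin n)) (i : Fin n),
        ((S.map Fin.castSuccEmb).filter (· < i.castSucc)).card = (S.filter (· < i)).card := by
      intro S i
      rw [Finset.filter_map, Finset.card_map]
      congr 1
    split_ifs at h with hlt
    · have he0 : 0 < e := Nat.pos_of_ne_zero (by rintro rfl; simp at hlt)
      obtain ⟨S, hS, hle⟩ := ih h (by omega)
      refine ⟨S.map Fin.castSuccEmb, by rw [Finset.card_map]; omega, fun i hi => ?_⟩
      obtain ⟨j, hj, rfl⟩ := Finset.mem_map.mp hi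
      have := hle j hj
      rw [Fin.coe_castSuccEmb, hfilter]
      exact this
    -- When `e = n + 2`, the required set is empty and nothing more is collected.
    · rcases he.eq_or_lt with rfl | he
      · exact ⟨∅, by simp, by simp⟩
      obtain ⟨S, hS, hle⟩ := ih h (by omega)
      have hlast : Fin.last n ∉ S.map Fin.castSuccEmb := by
        simp [Fin.castSucc_ne_last]
      refine ⟨Finset.cons _ _ hlast, by rw [Finset.card_cons, Finset.card_map]; omega,
        fun i hi => ?_⟩
      rw [Finset.mem_cons] at hi
      rcases hi with rfl | hi
      · rw [Finset.filter_cons_of_neg (· < Fin.last n) _ _ _ (lt_irrefl _), Finset.filter_true_of_mem,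
          Finset.card_map, Fin.val_last, show n + 1 - S.card = e by omega]
        · exact not_lt.mp hlt
        · intro j hj
          obtain ⟨j, -, rfl⟩ := Finset.mem_map.mp hj
          exact Fin.castSucc_lt_last j
      · obtain ⟨j, hj, rfl⟩ := Finset.mem_map.mp hi
        have := hle j hj
        rw [Fin.coe_castSuccEmb, Finset.filter_cons_of_neg (· < j.castSucc) _ _ _
          (not_lt.mpr (Fin.castSucc_lt_last j).le), hfilter]
        exact this

/-- List `U` first and then the rest of `V`, so that an index below `U.card` signals membership in
`U`. -/
lemma exists_enumeration {α : Type*} [Inhabited α] {U V : Finset α} (hUV : U ⊆ V) :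
    ∃ b : ℕ → α, Set.InjOn b {q | q < V.card} ∧ (∀ q < V.card, b q ∈ V) ∧
      ∀ q < U.card, b q ∈ U := by
  classical
  let l := U.toList ++ (V \ U).toList
  have hl : l.length = V.card := by
    rw [List.length_append, Finset.length_toList, Finset.length_toList, add_comm,
      Finset.card_sdiff_add_card_eq_card hUV]
  have hnd : l.Nodup := by
    refine List.Nodup.append (Finset.nodup_toList _) (Finset.nodup_toList _) ?_
    intro x hx hx'
    simp only [Finset.mem_toList, Finset.mem_sdiff] at hx hx'
    exact hx'.2 hx
  refine ⟨fun q => l.getD q default, ?_, ?_, ?_⟩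
  · intro p hp q hq h
    change p < _ at hp
    change q < _ at hq
    simp only at h
    rw [List.getD_eq_getElem _ _ (hl ▸ hp), List.getD_eq_getElem _ _ (hl ▸ hq)] at h
    exact (hnd.getElem_inj_iff).mp h
  · intro q hq
    simp only
    rw [List.getD_eq_getElem _ _ (hl ▸ hq)]
    have := List.getElem_mem (l := l) (hl ▸ hq)
    rw [List.mem_append, Finset.mem_toList, Finset.mem_toList, Finset.mem_sdiff] at this
    rcases this with h | h
    · exact hUV h
    · exact h.1
  · intro q hq
    simp only
    have hq' : q < U.toList.length := by rwa [Finset.length_toList]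
    rw [List.getD_append _ _ _ _ hq', List.getD_eq_getElem _ _ hq']
    exact Finset.mem_toList.mp (List.getElem_mem hq')

/-- The last entry of `a` is an index into an enumeration of `V` that starts with the `r * |E|`
elements whose `r`-th power lies in `E`. An index in this initial segment attains one value, which
is removed from `E` before the earlier coordinates are chosen. The enumeration depends only on `E`,
so the coordinates can be decoded from last to first, which gives injectivity. -/
lemma exists_injOn_of_scanSucceeds {r : ℕ} {V A : Finset ℂ}
    (hV : ∀ E ⊆ A, (V.filter (· ^ r ∈ E)).card = r * E.card) (n : ℕ) (E : Finset ℂ) (hE : E ⊆ A) :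
    ∃ φ : (Fin n → ℕ) → (Fin n → ℂ), Set.InjOn φ {a | ∀ i, a i < V.card} ∧
      ∀ a, (∀ i, a i < V.card) → (∀ i, φ a i ∈ V) ∧
        (ScanSucceeds r n a E.card → ∀ x ∈ E, ∃ i, φ a i ^ r = x) := by
  classical
  induction n generalizing E with
  | zero =>
    refine ⟨fun _ => Fin.elim0, fun a _ b _ _ => Subsingleton.elim _ _, fun a _ =>
      ⟨fun i => i.elim0, fun h x hx => ?_⟩⟩
    rw [Finset.card_eq_zero.mp h] at hx
    simp at hx
  | succ n ih =>
    obtain ⟨b, hinj, hbV, hbE⟩ := exists_enumeration (Finset.filter_subset (· ^ r ∈ E) V)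
    rw [hV E hE] at hbE
    let E' : ℕ → Finset ℂ := fun q => if q < r * E.card then E.erase (b q ^ r) else E
    have hE' : ∀ q, E' q ⊆ A := by
      intro q
      simp only [E']
      split_ifs
      · exact (Finset.erase_subset _ _).trans hE
      · exact hE
    have hcard : ∀ q, (E' q).card = if q < r * E.card then E.card - 1 else E.card := by
      intro q
      simp only [E']
      split_ifs with h
      · exact Finset.card_erase_of_mem (Finset.mem_filter.mp (hbE q h)).2
      · rfl
    choose φ hφinj hφ using fun q => ih (E' q) (hE' q)
    refine ⟨fun a => Fin.snoc (φ (a (Fin.last n)) (Fin.init a)) (b (a (Fin.last n))), ?_, ?_⟩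
    · intro a ha a' ha' h
      simp only at h
      have h1 := congrFun h (Fin.last n)
      rw [Fin.snoc_last, Fin.snoc_last] at h1
      have hlast := hinj (ha _) (ha' _) h1
      have h2 := congrArg Fin.init h
      rw [Fin.init_snoc, Fin.init_snoc, hlast] at h2
      have hinit : Fin.init a = Fin.init a' := hφinj _ (fun i => ha _) (fun i => ha' _) h2
      rw [← Fin.snoc_init_self a, ← Fin.snoc_init_self a', hinit, hlast]
    · intro a ha
      obtain ⟨h1, h2⟩ := hφ (a (Fin.last n)) (Fin.init a) fun i => ha _
      refine ⟨fun i => ?_, fun hs x hx => ?_⟩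
      · refine Fin.lastCases ?_ (fun j => ?_) i
        · simpa using hbV _ (ha _)
        · simpa using h1 j
      · rw [ScanSucceeds, ← hcard] at hs
        by_cases hxE : x ∈ E' (a (Fin.last n))
        · obtain ⟨i, hi⟩ := h2 hs x hxE
          exact ⟨i.castSucc, by simpa using hi⟩
        · refine ⟨Fin.last n, ?_⟩
          simp only [E'] at hxE
          split_ifs at hxE with h
          · simp only [Finset.mem_erase, not_and, hx, not_true_eq_false, imp_false,
              not_not] at hxE
            simpa using hxE.symm
          · exact (hxE hx).elim

/-- The exponents below `B` in each entry on which the scan succeeds. -/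
def scanExponents (n r k B : ℕ) : Finset (Fin n →₀ ℕ) := by
  classical
  exact ((Fintype.piFinset fun _ : Fin n => Finset.range B).filter
    fun a => ScanSucceeds r n a k).map Finsupp.equivFunOnFinite.symm.toEmbedding

lemma mem_scanExponents {n r k B : ℕ} {a : Fin n →₀ ℕ} :
    a ∈ scanExponents n r k B ↔ (∀ i, a i < B) ∧ ScanSucceeds r n a k := by
  classical
  rw [scanExponents, Finset.mem_map_equiv, Finset.mem_filter, Fintype.mem_piFinset]
  simp only [Finset.mem_range]
  rfl

/-- The points with coordinates in `V` whose `r`-th powers attain every element of `A`. -/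
def coveringPoints (n r : ℕ) (V A : Finset ℂ) : Finset (Fin n → ℂ) := by
  classical
  exact (Fintype.piFinset fun _ : Fin n => V).filter fun y => ∀ x ∈ A, ∃ i, y i ^ r = x

lemma mem_coveringPoints {n r : ℕ} {V A : Finset ℂ} {y : Fin n → ℂ} :
    y ∈ coveringPoints n r V A ↔ (∀ i, y i ∈ V) ∧ ∀ x ∈ A, ∃ i, y i ^ r = x := by
  simp [coveringPoints]

lemma card_scanExponents_le {n r : ℕ} {V A : Finset ℂ}
    (hV : ∀ E ⊆ A, (V.filter (· ^ r ∈ E)).card = r * E.card) :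
    (scanExponents n r A.card V.card).card ≤ (coveringPoints n r V A).card := by
  classical
  obtain ⟨φ, hinj, hφ⟩ := exists_injOn_of_scanSucceeds hV n A subset_rfl
  refine Finset.card_le_card_of_injOn (fun a => φ a) ?_ ?_
  · intro a ha
    obtain ⟨h1, h2⟩ := mem_scanExponents.mp ha
    exact mem_coveringPoints.mpr ⟨(hφ _ h1).1, (hφ _ h1).2 h2⟩
  · intro a ha a' ha' h
    exact DFunLike.coe_injective
      (hinj (mem_scanExponents.mp ha).1 (mem_scanExponents.mp ha').1 h)

/-! ### The basis theorem for a general set of coordinates. -/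

/-- The hypothesis `hV` says that each element of `A` has `r` roots in `V`; further elements of `V`
are allowed, which covers both ideals at once. -/
theorem isStandardMonomialBasis_of_card {n k r : ℕ} (hkn : k ≤ n) (hr : 0 < r)
    {V A : Finset ℂ} (hA : A.card = k)
    (hV : ∀ E ⊆ A, (V.filter (· ^ r ∈ E)).card = r * E.card) :
    IsStandardMonomialBasis (MonomialOrder.lex : MonomialOrder (Fin n))
      (Ideal.span ({f | ∃ i : Fin n, f = X i ^ V.card} ∪
        {f | ∃ d : ℕ, n - k + 1 ≤ d ∧ d ≤ n ∧ f = esymmPow n r d}))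
      {a | (∀ i, a i < V.card) ∧ ∀ S : Finset (Fin n), S.card = n - k + 1 →
        ¬ skipExponent r S ≤ a} := by
  classical
  set I : Ideal (MvPolynomial (Fin n) ℂ) := Ideal.span ({f | ∃ i : Fin n, f = X i ^ V.card} ∪
        {f | ∃ d : ℕ, n - k + 1 ≤ d ∧ d ≤ n ∧ f = esymmPow n r d}) with hI
  let Y := coveringPoints n r V A
  have hmul : ∀ g ∈ I, g ≠ 0 → ∀ a, (MonomialOrder.lex : MonomialOrder (Fin n)).degree g ≤ a →
      ∃ f ∈ I, f ≠ 0 ∧ (MonomialOrder.lex : MonomialOrder (Fin n)).degree f = a := by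
    intro g hg hg0 a hle
    refine ⟨monomial (a - MonomialOrder.lex.degree g) 1 * g, Ideal.mul_mem_left _ _ hg,
      mul_ne_zero (by simp) hg0, ?_⟩
    rw [degree_mul (by simp) hg0, degree_monomial, if_neg one_ne_zero, tsub_add_cancel_of_le hle]
  have hskip : ∀ a, ¬ ((∀ i, a i < V.card) ∧ ∀ S : Finset (Fin n), S.card = n - k + 1 →
      ¬ skipExponent r S ≤ a) →
      ∃ f ∈ I, f ≠ 0 ∧ (MonomialOrder.lex : MonomialOrder (Fin n)).degree f = a := by
    intro a ha
    rw [not_and_or] at ha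
    rcases ha with ha | ha
    · push Not at ha
      obtain ⟨i, hi⟩ := ha
      refine hmul (X i ^ V.card) (Ideal.subset_span (Or.inl ⟨i, rfl⟩)) (by simp) a ?_
      rw [X_pow_eq_monomial, degree_monomial, if_neg one_ne_zero]
      simpa using hi
    · push Not at ha
      obtain ⟨S, hS, hle⟩ := ha
      obtain ⟨f, hf, hf0, hd⟩ := exists_degree_eq_skipExponent hr S (by omega)
      rw [hS] at hf
      exact hmul f (Ideal.span_mono Set.subset_union_right hf) hf0 a (hd ▸ hle)
  have hscan : ∀ a, a ∉ scanExponents n r k V.card →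
      ¬ ((∀ i, a i < V.card) ∧ ∀ S : Finset (Fin n), S.card = n - k + 1 →
      ¬ skipExponent r S ≤ a) := by
    rintro a ha ⟨h1, h2⟩
    rw [mem_scanExponents, not_and] at ha
    obtain ⟨S, hS, hle⟩ := exists_skip_of_not_scanSucceeds (ha h1) (by omega)
    refine h2 S (by omega) fun i => ?_
    rw [skipExponent_apply]
    split_ifs with hi
    · exact hle i hi
    · exact Nat.zero_le _
  have htop : I ≤ topIdeal (Y : Set (Fin n → ℂ)) := by
    rw [hI, Ideal.span_le]
    rintro _ (⟨i, rfl⟩ | ⟨d, hd, -, rfl⟩)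
    · exact X_pow_mem_topIdeal V i fun y hy => (mem_coveringPoints.mp hy).1 i
    · exact esymmPow_mem_topIdeal hr A (fun y hy => (mem_coveringPoints.mp hy).2) (by omega)
  refine isStandardMonomialBasis_of_mem_iff _ _ _ fun a => ⟨?_, fun h => ?_⟩
  · rintro ha ⟨f, hf, hf0, rfl⟩
    obtain ⟨F, hF0, hF, hd⟩ := exists_degLex_degree_eq (htop hf) hf0
    have hcard := card_scanExponents_le (n := n) hV
    rw [hA] at hcard
    -- Elements of the ideal with prescribed lex degree supply the vanishing polynomials needed
    -- outside the scanned set; `F` then has its degree outside that set too.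
    have := degree_notMem_of_card_le (degLex : MonomialOrder (Fin n)) Y
      (scanExponents n r k V.card) hcard (fun b hb => by
        obtain ⟨g, hg, hg0, rfl⟩ := hskip b (hscan b hb)
        exact exists_degLex_degree_eq (htop hg) hg0) hF0 hF
    rw [hd] at this
    exact hscan _ this ha
  · by_contra ha
    exact h (hskip a ha)

/-! ### The sets of `r`-th roots, and the translation of the nonskip conditions to exponents. -/

lemma card_nthRootsFinset_biUnion {r : ℕ} (hr : 0 < r) (E : Finset ℂ) (hE : (0 : ℂ) ∉ E) :
    (E.biUnion fun x => (Polynomial.nthRoots r x).toFinset).card = r * E.card := by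
  have hζ := Complex.isPrimitiveRoot_exp r hr.ne'
  rw [Finset.card_biUnion]
  · rw [Finset.sum_const_nat (m := r), mul_comm]
    intro x hx
    have hx0 : x ≠ 0 := fun h => hE (h ▸ hx)
    rw [Multiset.toFinset_card_of_nodup (hζ.nthRoots_nodup hx0), hζ.card_nthRoots, if_pos]
    obtain ⟨z, hz⟩ := IsAlgClosed.exists_pow_nat_eq x hr
    exact ⟨z, hz⟩
  · intro x _ y _ hxy
    rw [Function.onFun, Finset.disjoint_left]
    intro z hz hz'
    rw [Multiset.mem_toFinset, Polynomial.mem_nthRoots hr] at hz hz'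
    exact hxy (hz.symm.trans hz')

lemma exists_card_eq_zero_notMem (k : ℕ) : ∃ A : Finset ℂ, A.card = k ∧ (0 : ℂ) ∉ A := by
  refine ⟨(Finset.range k).map ⟨fun j : ℕ => (j : ℂ) + 1, fun i j h => by simpa using h⟩, by simp, ?_⟩
  simp only [Finset.mem_map, Finset.mem_range, not_exists, not_and]
  exact fun j _ => Nat.cast_add_one_ne_zero j

lemma filter_nthRoots {r : ℕ} (hr : 0 < r) {A E W : Finset ℂ} (hE : E ⊆ A)
    (hW : (A.biUnion fun x => (Polynomial.nthRoots r x).toFinset) ⊆ W) :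
    W.filter (· ^ r ∈ E) = E.biUnion fun x => (Polynomial.nthRoots r x).toFinset := by
  ext z
  have hmem : ∀ B : Finset ℂ, z ∈ (B.biUnion fun x => (Polynomial.nthRoots r x).toFinset) ↔
      z ^ r ∈ B := by
    intro B
    simp [Polynomial.mem_nthRoots hr]
  rw [Finset.mem_filter, hmem]
  exact ⟨fun h => h.2, fun h => ⟨hW ((hmem A).mpr (hE h)), h⟩⟩

lemma isNonskip_iff {n k r : ℕ} (a : Fin n →₀ ℕ) :
    IsNonskip n k r a ↔ (∀ i, a i < k * r + 1) ∧
      ∀ S : Finset (Fin n), S.card = n - k + 1 → ¬ skipExponent r S ≤ a := by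
  simp only [IsNonskip, skipMonomial_pow, X_pow_eq_monomial, monomial_one_dvd_monomial_one,
    Finsupp.single_le_iff, not_le]

lemma isStronglyNonskip_iff {n k r : ℕ} (a : Fin n →₀ ℕ) :
    IsStronglyNonskip n k r a ↔ (∀ i, a i < k * r) ∧
      ∀ S : Finset (Fin n), S.card = n - k + 1 → ¬ skipExponent r S ≤ a := by
  simp only [IsStronglyNonskip, isNonskip_iff, X_pow_eq_monomial, monomial_one_dvd_monomial_one,
    Finsupp.single_le_iff, not_le]
  exact ⟨fun h => ⟨h.2, h.1.2⟩, fun h => ⟨⟨fun i => (h.1 i).trans (Nat.lt_succ_self _), h.2⟩, h.1⟩⟩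

end GeneralizedCoinvariant

end

/-- With respect to the lexicographic order with `x_1 > x_2 > ⋯ > x_n`, the nonskip monomials are
the standard monomial basis of `R_{n,k} = ℂ[x_1, …, x_n] / I_{n,k}`, and the strongly nonskip
monomials are the standard monomial basis of `S_{n,k} = ℂ[x_1, …, x_n] / J_{n,k}`. -/
theorem mainTheorem3 (n k r : ℕ) (hk : 1 ≤ k) (hkn : k ≤ n) (hr : 2 ≤ r) :
    GeneralizedCoinvariant.IsStandardMonomialBasis (MonomialOrder.lex : MonomialOrder (Fin n))
      (GeneralizedCoinvariant.idealI n k r)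
      (GeneralizedCoinvariant.nonskipMonomials n k r) ∧
    GeneralizedCoinvariant.IsStandardMonomialBasis (MonomialOrder.lex : MonomialOrder (Fin n))
      (GeneralizedCoinvariant.idealJ n k r)
      (GeneralizedCoinvariant.stronglyNonskipMonomials n k r) := by
  classical
  open GeneralizedCoinvariant in
  have hr0 : 0 < r := by omega
  obtain ⟨A, hA, hA0⟩ := exists_card_eq_zero_notMem k
  let W : Finset ℂ := A.biUnion fun x => (Polynomial.nthRoots r x).toFinset
  have hW : W.card = k * r := by
    rw [card_nthRootsFinset_biUnion hr0 A hA0, hA, mul_comm]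
  have h0W : (0 : ℂ) ∉ W := by
    simpa [W, Polynomial.mem_nthRoots hr0, hr0.ne'] using hA0
  have hcard : ∀ V, W ⊆ V → ∀ E ⊆ A, (V.filter (· ^ r ∈ E)).card = r * E.card := by
    intro V hV E hE
    rw [filter_nthRoots hr0 hE hV, card_nthRootsFinset_biUnion hr0 E fun h => hA0 (hE h)]
  constructor
  -- Adding the coordinate `0` raises the cardinality to `k * r + 1` without changing the fibres
  -- over `A`, since `0 ∉ A`.
  · have h := isStandardMonomialBasis_of_card hkn hr0 hA
      (hcard (Finset.cons 0 W h0W) (Finset.subset_cons _))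
    rw [Finset.card_cons, hW] at h
    simp only [nonskipMonomials, isNonskip_iff]
    exact h
  · have h := isStandardMonomialBasis_of_card hkn hr0 hA (hcard W subset_rfl)
    rw [hW] at h
    simp only [stronglyNonskipMonomials, isStronglyNonskip_iff]
    exact h
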